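/- An infinite word $w=w_0w_1w_2\cdots$ over the alphabet $\{1,2\}$ is \emph{Sturmian} if, for every $n\in\mathbb{N}$, it has exactly $n+1$ distinct factors (blocks of consecutive letters) of length $n$. A Sturmian word is \emph{of type} $1$ if $11$ is one of its factors, and \emph{of type} $2$ otherwise. For $i\in\{1,2\}$, with $j$ the other letter, let $R_i(w)$ be the infinite word obtained from $w$ by erasing every letter $i$ that immediately precedes an occurrence of $j$ (an initial $j$ is simply kept). The renormalization of $w$ is $R(w)=R_i(w)$, where $i$ is the type of $w$. Let $i_n\in\{1,2\}$ be the type of the iterate $R^n(w)$, so that $R_{i_0},R_{i_1},R_{i_2},\dots$ are the operators successively applied when $R$ is iterated on $w$. The \emph{run-length sequence} of $w$ under $R$ is the sequence $(b_n)_{n\in\mathbb{N}}$ of natural numbers, with $b_n\ge 1$ for all $n\ge 1$ (and $b_0\geq 0$), such that $$i_0i_1i_2i_3\cdots = 1^{b_0}2^{b_1}1^{b_2}2^{b_3}\cdots .$$ \textbf{Theorem.} Let $w$ be a Sturmian word over $\{1,2\}$. Then its run-length sequence $(b_n)_{n\in\mathbb{N}}$ under iteration of $R$ exists and is unique, and: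 (i) $w$ admits letter frequencies: for $a\in\{1,2\}$, the limit $f_a=\lim_{n\to\infty}\frac1n\,\#\{0\le k<n : w_k=a\}$ exists; (ii) $[b_0;b_1,b_2,b_3,\dots]$ is the continued fraction expansion of $f_1/f_2$, i.e. the (infinite) sequence of partial quotients produced by the continued fraction algorithm (output $\lfloor x\rfloor$, then, if $\{x\}\neq0$, continue with $1/\{x\}$) applied to $x=f_1/f_2$; (iii) $f_1/f_2$ is irrational. -/

import Mathlib

namespace Sturmian

/-- The two-letter alphabet `{1, 2}`. -/
inductive Letter where
  | one : Letter
  | two : Letter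
  deriving DecidableEq

/-- The factors of length `n` of the infinite word `w`: the blocks of `n` consecutive letters
that occur in `w`. -/
def factors {A : Type*} (w : ℕ → A) (n : ℕ) : Set (Fin n → A) :=
  {u | ∃ k : ℕ, ∀ t : Fin n, u t = w (k + t)}

/-- The complexity function of `w`: the number of factors of each length. -/
noncomputable def complexity {A : Type*} (w : ℕ → A) (n : ℕ) : ℕ :=
  (factors w n).ncard

/-- An infinite word over `{1, 2}` is Sturmian if it has exactly `n + 1` factors of length `n`,
for every `n`. -/
def IsSturmian (w : ℕ → Letter) : Prop :=
  ∀ n : ℕ, complexity w n = n + 1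

open Classical in
/-- The type of a word: `1` if the word contains the factor `11`, and `2` otherwise. -/
noncomputable def wordType (w : ℕ → Letter) : Letter :=
  if ![Letter.one, Letter.one] ∈ factors w 2 then Letter.one else Letter.two

/-- Position `n` survives the erasure operator `R_i` unless it carries a letter `i` that
immediately precedes an occurrence of the other letter. -/
def Kept (i : Letter) (w : ℕ → Letter) (n : ℕ) : Prop :=
  ¬ (w n = i ∧ w (n + 1) ≠ i)

/-- Infinitely many positions are kept, so that erasing the others leaves an infinite word. -/
theorem infinite_kept (i : Letter) (w : ℕ → Letter) : {n | Kept i w n}.Infinite := by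
  rw [Set.infinite_iff_exists_gt]
  intro a
  by_cases h : Kept i w (a + 1)
  · exact ⟨a + 1, h, Nat.lt_succ_self a⟩
  · have h' : w (a + 1) = i ∧ w (a + 1 + 1) ≠ i := not_not.mp h
    exact ⟨a + 1 + 1, fun hh => h'.2 hh.1, by omega⟩

/-- The operator `R_i`: erase from `w` the letter `i` that immediately precedes each occurrence of
the other letter. The `k`-th letter of the new word is the letter of `w` at the `k`-th kept
position. -/
noncomputable def eraseBefore (i : Letter) (w : ℕ → Letter) : ℕ → Letter :=
  fun k => w (Nat.nth (Kept i w) k)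

/-- The renormalization `R`: apply `R_i`, where `i` is the type of `w`. -/
noncomputable def renorm (w : ℕ → Letter) : ℕ → Letter :=
  eraseBefore (wordType w) w

/-- The sequence `i₀ i₁ i₂ …` of indices of the operators `R_{i₀}, R_{i₁}, …` that are
successively applied when `R` is iterated on `w`. -/
noncomputable def operatorSeq (w : ℕ → Letter) : ℕ → Letter :=
  fun n => wordType (renorm^[n] w)

/-- `b` is the run-length sequence of `s`, that is, `s = 1^{b 0} 2^{b 1} 1^{b 2} 2^{b 3} …`, where
only `b 0` may vanish: the `k`-th run occupies the `b k` positions that follow the previous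
runs. -/
def IsRunLength (s : ℕ → Letter) (b : ℕ → ℕ) : Prop :=
  (∀ k : ℕ, 1 ≤ k → 0 < b k) ∧
    ∀ k m : ℕ, m < b k →
      s ((∑ l ∈ Finset.range k, b l) + m) = if Even k then Letter.one else Letter.two

/-- The letter `a` has frequency `f` in `w`: the proportion of `a` among the first `n` letters of
`w` tends to `f`. -/
def HasFrequency (w : ℕ → Letter) (a : Letter) (f : ℝ) : Prop :=
  Filter.Tendsto (fun n : ℕ => (Nat.count (fun k => w k = a) n : ℝ) / (n : ℝ))
    Filter.atTop (nhds f)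

/-- The continued fraction expansion of `x`, as computed by the continued fraction algorithm, is
infinite and equal to `[b 0; b 1, b 2, …]`. -/
def HasContFractExpansion (x : ℝ) (b : ℕ → ℕ) : Prop :=
  (GenContFract.of x).h = (b 0 : ℝ) ∧
    ∀ n : ℕ, (GenContFract.of x).s.get? n = some ⟨1, (b (n + 1) : ℝ)⟩

end Sturmian

/-!
A word is Sturmian exactly when it has one right special factor of each length, since the number
of factors of length `n + 1` exceeds that of length `n` by the number of right special factors of
length `n`. In a Sturmian word `w` of type `i` the letter `j ≠ i` is isolated, and erasing the
letter `i` before each `j` puts the right special factors of `w` that begin with a kept letter in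
correspondence with those of `R w`. Hence `R w` is again Sturmian. The type of the iterates cannot
be eventually constant, because the gap between two occurrences of `j` shrinks as long as the type
is `i`. So the run-length sequence exists.

On letter counts of long prefixes `R_i` acts, up to a bounded error, by subtracting from the count
of `i` the count of `j`. Every cluster point `(f₁, f₂)` of the letter proportions is therefore
transformed by the subtractive Euclidean algorithm, with the types of the iterates as instructions,
and it remains nonnegative. A run of `b` subtractions is one step of the continued fraction
algorithm on the ratio of the coordinates, so that `f₁ / f₂ = [b 0; b 1, b 2, …]`. The cluster point
is thus unique, and compactness of the simplex gives convergence.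
-/

namespace Sturmian

namespace Letter

instance : Fintype Letter := ⟨{one, two}, fun a => by cases a <;> simp⟩

/-- The letter `j ≠ i`, so that statements can treat both letters of the alphabet alike. -/
def other : Letter → Letter
  | one => two
  | two => one

theorem other_ne (a : Letter) : a.other ≠ a := by cases a <;> decide

theorem other_other (a : Letter) : a.other.other = a := by cases a <;> rfl

theorem ne_iff_eq_other {a b : Letter} : a ≠ b ↔ a = b.other := by
  cases a <;> cases b <;> decide

end Letter

/-! ### Right special factors -/

section RightSpecial

variable {A : Type*} {w : ℕ → A} {m n p q : ℕ}

/-- The factor of length `n` of `w` read from position `p`. -/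
def block (w : ℕ → A) (n p : ℕ) : Fin n → A := fun t => w (p + t)

theorem block_eq_block : block w n p = block w n q ↔ ∀ t < n, w (p + t) = w (q + t) := by
  simp only [block, funext_iff, Fin.forall_iff]

theorem factors_eq_range (w : ℕ → A) (n : ℕ) : factors w n = Set.range (block w n) := by
  ext u
  simp only [factors, block, Set.mem_ofPred_eq, Set.mem_range, funext_iff, eq_comm]

theorem block_succ_eq_snoc (w : ℕ → A) (n p : ℕ) :
    block w (n + 1) p = Fin.snoc (α := fun _ => A) (block w n p) (w (p + n)) := by
  rw [← Fin.snoc_init_self (block w (n + 1) p)]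
  rfl

/-- The words read in `w` from the positions `p` and `q` agree for exactly `n` letters. Thus
`block w n p` is right special, and this relation describes right special factors by positions. -/
def DivergeAfter (w : ℕ → A) (n p q : ℕ) : Prop :=
  block w n p = block w n q ∧ w (p + n) ≠ w (q + n)

theorem exists_divergeAfter (h : w (p + n) ≠ w (q + n)) : ∃ m, DivergeAfter w m p q := by
  classical
  have hex : ∃ m, w (p + m) ≠ w (q + m) := ⟨n, h⟩
  exact ⟨Nat.find hex, block_eq_block.mpr fun t ht => not_not.mp (Nat.find_min hex ht),
    Nat.find_spec hex⟩

theorem DivergeAfter.length_le (hm : DivergeAfter w m p q) (hn : DivergeAfter w n p q) :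
    m ≤ n := by
  by_contra! hlt
  exact hn.2 (block_eq_block.mp hm.1 n hlt)

theorem DivergeAfter.length_unique (hm : DivergeAfter w m p q) (hn : DivergeAfter w n p q) :
    m = n :=
  (hm.length_le hn).antisymm (hn.length_le hm)

theorem DivergeAfter.suffix (h : DivergeAfter w (m + n) p q) :
    DivergeAfter w n (p + m) (q + m) := by
  refine ⟨block_eq_block.mpr fun t ht => ?_, ?_⟩
  · rw [add_assoc, add_assoc]
    exact block_eq_block.mp h.1 (m + t) (by omega)
  · rw [add_assoc, add_assoc]
    exact h.2

end RightSpecial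

section Complexity

variable {w : ℕ → Letter} {n : ℕ} {u : Fin n → Letter} {a : Letter}

/-- The factors of length `n` of `w` that have an occurrence followed by the letter `a`. -/
def factorsBefore (w : ℕ → Letter) (n : ℕ) (a : Letter) : Set (Fin n → Letter) :=
  {u | ∃ p, block w n p = u ∧ w (p + n) = a}

/-- The right special factors of length `n` of `w`: those that can be followed by each of the two
letters. -/
def rightSpecial (w : ℕ → Letter) (n : ℕ) : Set (Fin n → Letter) :=
  factorsBefore w n .one ∩ factorsBefore w n .two

theorem mem_rightSpecial_iff :
    u ∈ rightSpecial w n ↔ ∃ p q, block w n p = u ∧ DivergeAfter w n p q := by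
  constructor
  · rintro ⟨⟨p, rfl, hp⟩, q, hq, hq'⟩
    exact ⟨p, q, rfl, hq.symm, by rw [hp, hq']; decide⟩
  · rintro ⟨p, q, rfl, hpq, hne⟩
    cases hp : w (p + n)
    · exact ⟨⟨p, rfl, hp⟩, q, hpq.symm, by rw [Letter.ne_iff_eq_other.mp hne.symm, hp]; rfl⟩
    · exact ⟨⟨q, hpq.symm, by rw [Letter.ne_iff_eq_other.mp hne.symm, hp]; rfl⟩, p, rfl, hp⟩

theorem factorsBefore_union (w : ℕ → Letter) (n : ℕ) :
    factorsBefore w n .one ∪ factorsBefore w n .two = factors w n := by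
  rw [factors_eq_range]
  ext u
  constructor
  · rintro (⟨p, hp, -⟩ | ⟨p, hp, -⟩) <;> exact ⟨p, hp⟩
  · rintro ⟨p, hp⟩
    cases ha : w (p + n)
    · exact Or.inl ⟨p, hp, ha⟩
    · exact Or.inr ⟨p, hp, ha⟩

theorem snoc_mem_factors_iff :
    Fin.snoc (α := fun _ => Letter) u a ∈ factors w (n + 1) ↔ u ∈ factorsBefore w n a := by
  simp only [factors_eq_range, Set.mem_range, block_succ_eq_snoc, Fin.snoc_inj, factorsBefore,
    Set.mem_ofPred_eq]

theorem complexity_succ_eq_add_ncard_factorsBefore (w : ℕ → Letter) (n : ℕ) :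
    complexity w (n + 1) = (factorsBefore w n .one).ncard + (factorsBefore w n .two).ncard := by
  let extend (a : Letter) (u : Fin n → Letter) : Fin (n + 1) → Letter := Fin.snoc u a
  have hcover : factors w (n + 1) =
      extend .one '' factorsBefore w n .one ∪ extend .two '' factorsBefore w n .two := by
    ext v
    induction v using Fin.snocCases with
    | snoc u a =>
      rw [snoc_mem_factors_iff]
      cases a <;> simp [extend, Fin.snoc_inj]
  have hdisj : Disjoint (extend .one '' factorsBefore w n .one)
      (extend .two '' factorsBefore w n .two) := by
    simp [Set.disjoint_left, extend, Fin.snoc_inj]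
  have hinj (a : Letter) : Function.Injective (extend a) :=
    fun _ _ h => (Fin.snoc_inj.mp h).1
  rw [complexity, hcover, Set.ncard_union_eq hdisj, Set.ncard_image_of_injective _ (hinj _),
    Set.ncard_image_of_injective _ (hinj _)]

theorem complexity_succ (w : ℕ → Letter) (n : ℕ) :
    complexity w (n + 1) = complexity w n + (rightSpecial w n).ncard := by
  rw [complexity_succ_eq_add_ncard_factorsBefore, complexity, ← factorsBefore_union, rightSpecial,
    Set.ncard_union_add_ncard_inter]

theorem complexity_zero (w : ℕ → Letter) : complexity w 0 = 1 := by
  rw [complexity, Set.ncard_eq_one]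
  refine ⟨block w 0 0, Set.eq_singleton_iff_unique_mem.mpr ⟨?_, fun u _ => Subsingleton.elim _ _⟩⟩
  rw [factors_eq_range]
  exact ⟨0, rfl⟩

theorem isSturmian_iff_ncard_rightSpecial :
    IsSturmian w ↔ ∀ n, (rightSpecial w n).ncard = 1 := by
  constructor
  · intro hw n
    have hsucc := complexity_succ w n
    rw [hw, hw] at hsucc
    omega
  · intro h n
    induction n with
    | zero => exact complexity_zero w
    | succ n ih => rw [complexity_succ, ih, h]

theorem isSturmian_iff_divergeAfter :
    IsSturmian w ↔ ∀ n, (∃ p q, DivergeAfter w n p q) ∧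
      ∀ p q p' q', DivergeAfter w n p q → DivergeAfter w n p' q' →
        block w n p = block w n p' := by
  rw [isSturmian_iff_ncard_rightSpecial]
  refine forall_congr' fun n => ?_
  rw [Set.ncard_eq_one]
  constructor
  · rintro ⟨u, hu⟩
    have heq : ∀ p q, DivergeAfter w n p q → block w n p = u := fun p q h =>
      hu.subset (mem_rightSpecial_iff.mpr ⟨p, q, rfl, h⟩)
    obtain ⟨p, q, -, hpq⟩ := mem_rightSpecial_iff.mp (hu.superset rfl)
    exact ⟨⟨p, q, hpq⟩, fun p q p' q' h h' => (heq p q h).trans (heq p' q' h').symm⟩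
  · rintro ⟨⟨p, q, hpq⟩, huniq⟩
    refine ⟨block w n p, Set.eq_singleton_iff_unique_mem.mpr
      ⟨mem_rightSpecial_iff.mpr ⟨p, q, rfl, hpq⟩, fun u hu => ?_⟩⟩
    obtain ⟨p', q', rfl, hpq'⟩ := mem_rightSpecial_iff.mp hu
    exact huniq _ _ _ _ hpq' hpq

theorem IsSturmian.exists_divergeAfter (hw : IsSturmian w) (n : ℕ) :
    ∃ p q, DivergeAfter w n p q :=
  (isSturmian_iff_divergeAfter.mp hw n).1

theorem IsSturmian.block_eq_of_divergeAfter (hw : IsSturmian w) {p q p' q' : ℕ}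
    (h : DivergeAfter w n p q) (h' : DivergeAfter w n p' q') : block w n p = block w n p' :=
  (isSturmian_iff_divergeAfter.mp hw n).2 p q p' q' h h'

end Complexity

/-! ### The separating letter -/

section Separating

open Filter

variable {w : ℕ → Letter}

/-- The letter `i` separates `w`: every factor of length two contains it, so that the other letter
is isolated. -/
def IsSeparating (i : Letter) (w : ℕ → Letter) : Prop :=
  ∀ n, w n = i ∨ w (n + 1) = i

theorem IsSturmian.frequently_eq (hw : IsSturmian w) (a : Letter) : ∃ᶠ n in atTop, w n = a := by
  rw [frequently_atTop]
  intro N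
  obtain ⟨p, q, -, hne⟩ := hw.exists_divergeAfter N
  by_cases hp : w (p + N) = a
  · exact ⟨p + N, by omega, hp⟩
  · refine ⟨q + N, by omega, ?_⟩
    rw [Letter.ne_iff_eq_other.mp hne.symm, Letter.ne_iff_eq_other.mp hp, Letter.other_other]

theorem IsSturmian.exists_eq_and_succ_ne (hw : IsSturmian w) (a : Letter) :
    ∃ m, w m = a ∧ w (m + 1) ≠ a := by
  by_contra! h
  obtain ⟨k, hk⟩ := (hw.frequently_eq a).exists
  obtain ⟨m, hkm, hm⟩ := frequently_atTop.mp (hw.frequently_eq a.other) k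
  have hconst : ∀ l ≥ k, w l = a := fun l hl => Nat.le_induction hk (fun l _ => h l) l hl
  exact a.other_ne (hm.symm.trans (hconst m hkm))

/-- If both `aa` and `bb` occurred, then `a` and `b` would be two right special factors. -/
theorem IsSturmian.isSeparating_of_square (hw : IsSturmian w) {a : Letter} {k : ℕ}
    (hk : w k = a) (hk' : w (k + 1) = a) : IsSeparating a w := by
  intro n
  by_contra! hn
  obtain ⟨m, hm, hm'⟩ := hw.exists_eq_and_succ_ne a
  obtain ⟨l, hl, hl'⟩ := hw.exists_eq_and_succ_ne (w n)
  have hnn : w (n + 1) = w n := by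
    rw [Letter.ne_iff_eq_other.mp hn.1, Letter.ne_iff_eq_other.mp hn.2]
  have ha : DivergeAfter w 1 k m :=
    ⟨block_eq_block.mpr (by simp [hk, hm]), by rw [hk']; exact hm'.symm⟩
  have hb : DivergeAfter w 1 n l :=
    ⟨block_eq_block.mpr (by simp [hl]), by rw [hnn]; exact hl'.symm⟩
  have hkn : w k = w n := block_eq_block.mp (hw.block_eq_of_divergeAfter ha hb) 0 one_pos
  exact hn.1 (hkn.symm.trans hk)

theorem IsSturmian.isSeparating_wordType (hw : IsSturmian w) : IsSeparating (wordType w) w := by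
  unfold wordType
  split_ifs with h
  · obtain ⟨k, hk⟩ := h
    exact hw.isSeparating_of_square (hk 0).symm (hk 1).symm
  · intro n
    by_contra! hn
    refine h ⟨n, Fin.forall_fin_two.mpr ⟨?_, ?_⟩⟩
    · exact (Letter.ne_iff_eq_other.mp hn.1).symm
    · exact (Letter.ne_iff_eq_other.mp hn.2).symm

end Separating

/-! ### Erasure -/

section Erase

variable {i a : Letter} {w : ℕ → Letter} {m n p q : ℕ}

instance (i : Letter) (w : ℕ → Letter) : DecidablePred (Kept i w) :=
  fun n => inferInstanceAs (Decidable ¬(w n = i ∧ w (n + 1) ≠ i))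

theorem kept_of_ne (h : w n ≠ i) : Kept i w n := fun hn => h hn.1

theorem kept_of_succ_eq (h : w (n + 1) = i) : Kept i w n := fun hn => hn.2 h

theorem kept_congr (h : w p = w q) (h' : w (p + 1) = w (q + 1)) : Kept i w p ↔ Kept i w q := by
  rw [Kept, Kept, h, h']

theorem eraseBefore_count (h : Kept i w n) :
    eraseBefore i w (Nat.count (Kept i w) n) = w n := by
  rw [eraseBefore, Nat.nth_count h]

theorem eraseBefore_count_of_eq (h : w n = i) :
    eraseBefore i w (Nat.count (Kept i w) n) = w (n + 1) := by
  by_cases h' : w (n + 1) = i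
  · rw [eraseBefore_count (kept_of_succ_eq h'), h, h']
  · have hn : ¬Kept i w n := not_not.mpr ⟨h, h'⟩
    rw [← Nat.count_succ_eq_count_iff.mpr hn, eraseBefore_count (kept_of_ne h')]

theorem le_count_kept_add (i : Letter) (w : ℕ → Letter) (p n : ℕ) :
    n ≤ Nat.count (fun r => Kept i w (p + r)) (2 * n) := by
  induction n with
  | zero => exact Nat.zero_le _
  | succ n ih =>
    have hkept : Kept i w (p + 2 * n) ∨ Kept i w (p + (2 * n + 1)) :=
      or_iff_not_imp_left.mpr fun h => kept_of_ne (not_not.mp h).2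
    rw [show 2 * (n + 1) = 2 * n + 1 + 1 by ring, Nat.count_succ, Nat.count_succ]
    split_ifs <;> first | omega | tauto

theorem count_kept_add_congr (h : block w (n + 1) p = block w (n + 1) q) (hm : m ≤ n) :
    Nat.count (fun r => Kept i w (p + r)) m = Nat.count (fun r => Kept i w (q + r)) m := by
  have hagree := block_eq_block.mp h
  have hkept : ∀ r < m, (Kept i w (p + r) ↔ Kept i w (q + r)) := fun r hr =>
    kept_congr (hagree r (by omega)) (hagree (r + 1) (by omega))
  exact le_antisymm (Nat.count_mono_left fun r hr => (hkept r hr).mp)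
    (Nat.count_mono_left fun r hr => (hkept r hr).mpr)

theorem block_eraseBefore_congr (h : block w (n + 1) p = block w (n + 1) q) :
    block (eraseBefore i w) (Nat.count (fun r => Kept i w (p + r)) n)
        (Nat.count (Kept i w) p) =
      block (eraseBefore i w) (Nat.count (fun r => Kept i w (p + r)) n)
        (Nat.count (Kept i w) q) := by
  have hagree := block_eq_block.mp h
  refine block_eq_block.mpr fun m hm => ?_
  set r := Nat.nth (fun r => Kept i w (p + r)) m
  have hrn : r < n := Nat.nth_lt_of_lt_count hm
  have hcount : Nat.count (fun r => Kept i w (p + r)) r = m :=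
    Nat.count_nth fun hf => hm.trans_le (Nat.count_le_card hf n)
  have hp : Kept i w (p + r) :=
    Nat.nth_mem m fun hf => hm.trans_le (Nat.count_le_card hf n)
  have hq : Kept i w (q + r) :=
    (kept_congr (hagree r (by omega)) (hagree (r + 1) (by omega))).mp hp
  calc eraseBefore i w (Nat.count (Kept i w) p + m)
      = w (p + r) := by rw [← eraseBefore_count hp, Nat.count_add, hcount]
    _ = w (q + r) := hagree r (by omega)
    _ = eraseBefore i w (Nat.count (Kept i w) q + m) := by
      rw [← eraseBefore_count hq, Nat.count_add, ← count_kept_add_congr h hrn.le, hcount]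

/-- The last common letter must be `i`. It is erased exactly when the next letter differs from it,
so that in both words the next surviving letter is the one on which `w` diverges. -/
theorem DivergeAfter.eraseBefore (hi : IsSeparating i w) (h : DivergeAfter w (n + 1) p q) :
    DivergeAfter (eraseBefore i w) (Nat.count (fun r => Kept i w (p + r)) n)
      (Nat.count (Kept i w) p) (Nat.count (Kept i w) q) := by
  refine ⟨block_eraseBefore_congr h.1, ?_⟩
  have hlast : w (p + n) = w (q + n) := block_eq_block.mp h.1 n (lt_add_one n)
  have hp : w (p + n) = i := by
    rcases hi (p + n) with hp | hp
    · exact hp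
    · rcases hi (q + n) with hq | hq
      · exact hlast.trans hq
      · exact absurd (hp.trans hq.symm) h.2
  rw [← Nat.count_add, count_kept_add_congr h.1 le_rfl, ← Nat.count_add,
    eraseBefore_count_of_eq hp, eraseBefore_count_of_eq (hlast.symm.trans hp)]
  exact h.2

theorem exists_divergeAfter_of_eraseBefore (hi : IsSeparating i w)
    (h : DivergeAfter (eraseBefore i w) (n + 1) p q) :
    ∃ m, DivergeAfter w (m + 1) (Nat.nth (Kept i w) p) (Nat.nth (Kept i w) q) ∧
      Nat.count (fun r => Kept i w (Nat.nth (Kept i w) p + r)) m = n + 1 := by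
  have hcount : ∀ k, Nat.count (Kept i w) (Nat.nth (Kept i w) k) = k :=
    Nat.count_nth_of_infinite (infinite_kept i w)
  have hdiff : ∃ r, w (Nat.nth (Kept i w) p + r) ≠ w (Nat.nth (Kept i w) q + r) := by
    by_contra! hall
    refine h.2 ?_
    have hblock := block_eraseBefore_congr (i := i) (n := 2 * (n + 2))
      (block_eq_block.mpr fun r _ => hall r)
    rw [hcount, hcount] at hblock
    exact block_eq_block.mp hblock (n + 1) (le_count_kept_add i w _ (n + 2))
  obtain ⟨r, hr⟩ := hdiff
  obtain ⟨m, hm⟩ := exists_divergeAfter hr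
  have hfirst : w (Nat.nth (Kept i w) p) = w (Nat.nth (Kept i w) q) :=
    block_eq_block.mp h.1 0 n.succ_pos
  obtain ⟨m, rfl⟩ : ∃ k, m = k + 1 :=
    Nat.exists_eq_succ_of_ne_zero fun h0 => hm.2 (by rwa [h0])
  refine ⟨m, hm, ?_⟩
  have herase := hm.eraseBefore hi
  rw [hcount, hcount] at herase
  exact herase.length_unique h

/-- Of the two right special factors of `w` that lift the given ones, the shorter is a suffix of
the longer. Both have `n + 1` kept letters and start with a kept letter, so they are equal. -/
theorem IsSturmian.block_eraseBefore_eq (hw : IsSturmian w) (hi : IsSeparating i w)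
    {p q p' q' : ℕ} (h : DivergeAfter (Sturmian.eraseBefore i w) n p q)
    (h' : DivergeAfter (Sturmian.eraseBefore i w) n p' q') :
    block (Sturmian.eraseBefore i w) n p = block (Sturmian.eraseBefore i w) n p' := by
  obtain _ | n := n
  · exact Subsingleton.elim _ _
  obtain ⟨m, hm, hcount⟩ := exists_divergeAfter_of_eraseBefore hi h
  obtain ⟨m', hm', hcount'⟩ := exists_divergeAfter_of_eraseBefore hi h'
  wlog hle : m ≤ m' generalizing p q p' q' m m'
  · exact (this h' h m' hm' hcount' m hm hcount (by omega)).symm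
  obtain ⟨e, rfl⟩ := Nat.exists_eq_add_of_le' hle
  have hblock := hw.block_eq_of_divergeAfter hm (hm'.suffix (m := e) (n := m + 1))
  have he : e = 0 := by
    have hsuffix := count_kept_add_congr (i := i) hblock le_rfl
    rw [Nat.count_add] at hcount'
    simp only [add_assoc] at hsuffix hcount'
    have hnone : Nat.count (fun r => Kept i w (Nat.nth (Kept i w) p' + r)) e = 0 := by omega
    by_contra he
    exact Nat.count_iff_forall_not.mp hnone 0 (Nat.pos_of_ne_zero he)
      (Nat.nth_mem_of_infinite (infinite_kept i w) p')
  subst he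
  have herase := block_eraseBefore_congr (i := i) hblock
  rwa [hcount, add_zero, Nat.count_nth_of_infinite (infinite_kept i w),
    Nat.count_nth_of_infinite (infinite_kept i w)] at herase

theorem IsSturmian.exists_divergeAfter_eraseBefore (hw : IsSturmian w) (hi : IsSeparating i w)
    (n : ℕ) : ∃ p q, DivergeAfter (Sturmian.eraseBefore i w) n p q := by
  obtain ⟨p, q, h⟩ := hw.exists_divergeAfter (2 * n + 1)
  have herase := h.eraseBefore hi
  obtain ⟨e, he⟩ := Nat.exists_eq_add_of_le' (le_count_kept_add i w p n)
  rw [he] at herase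
  exact ⟨_, _, herase.suffix⟩

theorem IsSturmian.eraseBefore (hw : IsSturmian w) (hi : IsSeparating i w) :
    IsSturmian (eraseBefore i w) :=
  isSturmian_iff_divergeAfter.mpr fun n => ⟨hw.exists_divergeAfter_eraseBefore hi n,
    fun _ _ _ _ h h' => hw.block_eraseBefore_eq hi h h'⟩

end Erase

theorem IsSturmian.renorm {w : ℕ → Letter} (hw : IsSturmian w) : IsSturmian (renorm w) :=
  hw.eraseBefore hw.isSeparating_wordType

theorem IsSturmian.iterate_renorm {w : ℕ → Letter} (hw : IsSturmian w) (n : ℕ) :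
    IsSturmian (Sturmian.renorm^[n] w) :=
  Function.Iterate.rec IsSturmian hw (fun _ h => h.renorm) n

/-! ### The sequence of types -/

section OperatorSeq

open Filter

variable {i : Letter} {w : ℕ → Letter} {p q : ℕ}

/-- The letter before position `q` is erased, so the gap between the two letters shrinks. -/
theorem IsSeparating.exists_eraseBefore_ne_of_lt (hi : IsSeparating i w) (hpq : p < q)
    (hp : w p ≠ i) (hq : w q ≠ i) :
    ∃ p' q', p' < q' ∧ q' - p' < q - p ∧ eraseBefore i w p' ≠ i ∧ eraseBefore i w q' ≠ i := by
  refine ⟨Nat.count (Kept i w) p, Nat.count (Kept i w) q,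
    Nat.count_strict_mono (kept_of_ne hp) hpq, ?_, by rwa [eraseBefore_count (kept_of_ne hp)],
    by rwa [eraseBefore_count (kept_of_ne hq)]⟩
  obtain ⟨d, rfl⟩ := Nat.exists_eq_add_of_lt hpq
  have herased : ¬Kept i w (p + d) := not_not.mpr ⟨(hi (p + d)).resolve_right hq, hq⟩
  have hle : Nat.count (fun r => Kept i w (p + r)) d ≤ d := Nat.count_le _
  rw [Nat.count_succ_eq_count_iff.mpr herased, Nat.count_add]
  omega

theorem operatorSeq_iterate_renorm (w : ℕ → Letter) (N n : ℕ) :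
    operatorSeq (renorm^[N] w) n = operatorSeq w (n + N) := by
  rw [operatorSeq, operatorSeq, Function.iterate_add_apply]

/-- While `i` remains the type, the gap between two occurrences of the other letter shrinks at each
step. -/
theorem IsSturmian.exists_operatorSeq_ne (hw : IsSturmian w) (i : Letter) :
    ∃ n, operatorSeq w n ≠ i := by
  by_contra! hconst
  obtain ⟨p, hp⟩ := (hw.frequently_eq i.other).exists
  obtain ⟨q, hpq, hq⟩ := frequently_atTop.mp (hw.frequently_eq i.other) (p + 1)
  rw [← Letter.ne_iff_eq_other] at hp hq
  induction hd : q - p using Nat.strong_induction_on generalizing w p q with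
  | _ d ih =>
    have htype : wordType w = i := hconst 0
    obtain ⟨p', q', hpq', hlt, hp', hq'⟩ :=
      (htype ▸ hw.isSeparating_wordType).exists_eraseBefore_ne_of_lt hpq hp hq
    rw [← htype, ← Sturmian.renorm, htype] at hp' hq'
    exact ih (q' - p') (hd ▸ hlt) hw.renorm (fun n => hconst (n + 1)) p' hp' q' hpq' hq' rfl

theorem IsSturmian.frequently_operatorSeq_eq (hw : IsSturmian w) (i : Letter) :
    ∃ᶠ n in atTop, operatorSeq w n = i := by
  rw [frequently_atTop]
  intro N
  obtain ⟨n, hn⟩ := (hw.iterate_renorm N).exists_operatorSeq_ne i.other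
  rw [operatorSeq_iterate_renorm, Letter.ne_iff_eq_other, Letter.other_other] at hn
  exact ⟨n + N, Nat.le_add_left N n, hn⟩

end OperatorSeq

/-! ### Run lengths -/

section RunLength

open Filter

variable {s : ℕ → Letter} {b b' : ℕ → ℕ}

/-- The letter that fills the `k`-th run in `1^{b 0} 2^{b 1} 1^{b 2} ⋯`. -/
def runLetter (k : ℕ) : Letter := if Even k then Letter.one else Letter.two

theorem runLetter_succ (k : ℕ) : runLetter (k + 1) = (runLetter k).other := by
  by_cases h : Even k <;> simp [runLetter, h, Nat.even_add_one, Letter.other]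

theorem exists_first_eq_add {c : Letter} (hs : ∃ᶠ n in atTop, s n = c) (N : ℕ) :
    ∃ d, s (N + d) = c ∧ ∀ r < d, s (N + r) ≠ c := by
  obtain ⟨m, hm, hmc⟩ := frequently_atTop.mp hs N
  obtain ⟨d, rfl⟩ := Nat.exists_eq_add_of_le hm
  have hex : ∃ d, s (N + d) = c := ⟨d, hmc⟩
  exact ⟨Nat.find hex, Nat.find_spec hex, fun _ => Nat.find_min hex⟩

theorem exists_isRunLength (hs : ∀ c, ∃ᶠ n in atTop, s n = c) : ∃ b, IsRunLength s b := by
  choose len hlen hbefore using fun c N => exists_first_eq_add (hs c) N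
  let start (k : ℕ) : ℕ := Nat.rec 0 (fun k N => N + len (runLetter (k + 1)) N) k
  let b (k : ℕ) : ℕ := len (runLetter (k + 1)) (start k)
  have hsum (k : ℕ) : ∑ l ∈ Finset.range k, b l = start k :=
    Finset.sum_range_induction _ _ rfl k fun _ _ => rfl
  have hstart (k : ℕ) : s (start (k + 1)) = runLetter (k + 1) := hlen _ _
  refine ⟨b, fun k hk => ?_, fun k m hm => ?_⟩
  · obtain ⟨k, rfl⟩ := Nat.exists_eq_add_of_le' hk
    refine Nat.pos_of_ne_zero fun h0 => ?_
    have hnext : runLetter (k + 1 + 1) = runLetter (k + 1) := (hstart (k + 1)).symm.trans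
      ((congrArg (fun d => s (start (k + 1) + d)) h0).trans (hstart k))
    rw [runLetter_succ (k + 1)] at hnext
    exact Letter.other_ne _ hnext
  · have hne := hbefore _ _ m hm
    rw [hsum, ← runLetter]
    rwa [runLetter_succ, Letter.ne_iff_eq_other, Letter.other_other] at hne

theorem IsRunLength.le_of_forall_lt_eq (hb : IsRunLength s b) (hb' : IsRunLength s b') {k : ℕ}
    (h : ∀ l < k, b l = b' l) : b' k ≤ b k := by
  by_contra! hlt
  have hsum : ∑ l ∈ Finset.range k, b l = ∑ l ∈ Finset.range k, b' l :=
    Finset.sum_congr rfl fun l hl => h l (Finset.mem_range.mp hl)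
  have hin : s (∑ l ∈ Finset.range k, b l + b k) = runLetter k := hsum ▸ hb'.2 k (b k) hlt
  have hout : s (∑ l ∈ Finset.range k, b l + b k) = runLetter (k + 1) := by
    rw [← Finset.sum_range_succ]
    exact hb.2 (k + 1) 0 (hb.1 (k + 1) k.succ_pos)
  rw [hin, runLetter_succ] at hout
  exact Letter.other_ne _ hout.symm

theorem IsRunLength.unique (hb : IsRunLength s b) (hb' : IsRunLength s b') : b = b' := by
  funext k
  induction k using Nat.strong_induction_on with
  | _ k ih =>
    exact le_antisymm (hb'.le_of_forall_lt_eq hb fun l hl => (ih l hl).symm)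
      (hb.le_of_forall_lt_eq hb' ih)

end RunLength

/-! ### Continued fractions -/

section ContFract

variable {x y : ℝ} {b : ℕ → ℕ}

theorem hasContFractExpansion_of_recurrence {y : ℕ → ℝ} (hone : ∀ k, 1 < y (k + 1))
    (hy : ∀ k, y k = b k + (y (k + 1))⁻¹) : HasContFractExpansion (y 0) b := by
  have hpos (k : ℕ) : 0 < (y (k + 1))⁻¹ := inv_pos.mpr (one_pos.trans (hone k))
  have hfloor (k : ℕ) : ⌊y k⌋ = b k := by
    have hlt := inv_lt_one_of_one_lt₀ (hone k)
    rw [Int.floor_eq_iff, hy k, Int.cast_natCast]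
    constructor <;> linarith [hpos k]
  have hfract (k : ℕ) : Int.fract (y k) = (y (k + 1))⁻¹ := by
    rw [Int.fract, hfloor, hy k, Int.cast_natCast, add_sub_cancel_left]
  have hget (n : ℕ) : ∀ k, (GenContFract.of (y k)).s.get? n = some ⟨1, (b (k + n + 1) : ℝ)⟩ := by
    induction n with
    | zero =>
      intro k
      have hhead := GenContFract.of_s_head (v := y k) (by rw [hfract]; exact (hpos k).ne')
      rwa [hfract, inv_inv, hfloor, Int.cast_natCast] at hhead
    | succ n ih =>
      intro k
      rw [GenContFract.of_s_succ, hfract, inv_inv, ih, add_right_comm k 1 n, add_assoc k n 1]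
  refine ⟨by rw [GenContFract.of_h_eq_floor, hfloor, Int.cast_natCast], fun n => ?_⟩
  rw [hget, zero_add]

theorem HasContFractExpansion.unique (hx : HasContFractExpansion x b)
    (hy : HasContFractExpansion y b) : x = y := by
  have hof : GenContFract.of x = GenContFract.of y :=
    GenContFract.ext (hx.1.trans hy.1.symm)
      (Stream'.Seq.ext fun n => (hx.2 n).trans (hy.2 n).symm)
  have hlim := GenContFract.of_convergence x
  rw [hof] at hlim
  exact tendsto_nhds_unique hlim (GenContFract.of_convergence y)

theorem HasContFractExpansion.irrational (hx : HasContFractExpansion x b) : Irrational x := by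
  rintro ⟨q, hq⟩
  obtain ⟨n, hn⟩ := (GenContFract.terminates_iff_rat x).mpr ⟨q, hq.symm⟩
  have hnone : (GenContFract.of x).s.get? n = none := hn
  rw [hx.2 n] at hnone
  cases hnone

end ContFract

/-! ### The subtractive Euclidean algorithm -/

section Subtractive

open Filter

/-- Subtract from the coordinate `i` of a pair its other coordinate. This is how `R_i` acts on
letter counts, since it erases one letter `i` for each occurrence of the other letter. -/
def subtractAt {R : Type*} [Sub R] (i : Letter) (v : Letter → R) : Letter → R :=
  Function.update v i (v i - v i.other)

/-- The orbit of the pair `v` under the subtractive Euclidean algorithm, in which `s n` tells which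
coordinate is reduced at step `n`. -/
def subtractiveOrbit {R : Type*} [Sub R] (s : ℕ → Letter) (v : Letter → R) : ℕ → Letter → R
  | 0 => v
  | n + 1 => subtractAt (s n) (subtractiveOrbit s v n)

theorem subtractAt_self {R : Type*} [Sub R] (i : Letter) (v : Letter → R) :
    subtractAt i v i = v i - v i.other :=
  Function.update_self ..

theorem subtractAt_of_ne {R : Type*} [Sub R] {i a : Letter} (h : a ≠ i) (v : Letter → R) :
    subtractAt i v a = v a :=
  Function.update_of_ne h ..

section AddCommGroup

variable {R : Type*} [AddCommGroup R] {s : ℕ → Letter} {v : Letter → R}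

theorem subtractAt_ne_zero (i : Letter) (hv : v ≠ 0) : subtractAt i v ≠ 0 := by
  contrapose hv
  have hother : v i.other = 0 := by rw [← subtractAt_of_ne i.other_ne v, hv, Pi.zero_apply]
  have hself : v i = 0 := by
    have hvi := subtractAt_self i v
    rw [hv, hother, sub_zero, Pi.zero_apply] at hvi
    exact hvi.symm
  funext a
  by_cases ha : a = i
  · rw [ha, hself, Pi.zero_apply]
  · rw [Letter.ne_iff_eq_other.mp ha, hother, Pi.zero_apply]

theorem subtractiveOrbit_ne_zero (s : ℕ → Letter) (hv : v ≠ 0) (n : ℕ) :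
    subtractiveOrbit s v n ≠ 0 := by
  induction n with
  | zero => exact hv
  | succ n ih => exact subtractAt_ne_zero _ ih

theorem subtractiveOrbit_add_of_forall_eq {c : Letter} {N m : ℕ} (hm : ∀ r < m, s (N + r) = c) :
    subtractiveOrbit s v (N + m) = Function.update (subtractiveOrbit s v N) c
      (subtractiveOrbit s v N c - m • subtractiveOrbit s v N c.other) := by
  induction m with
  | zero => simp
  | succ m ih =>
    rw [← add_assoc, subtractiveOrbit, hm m (lt_add_one m), subtractAt,
      ih fun r hr => hm r (by omega), Function.update_idem, Function.update_self,
      Function.update_of_ne c.other_ne, succ_nsmul, sub_sub]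

variable [LinearOrder R] [IsOrderedAddMonoid R]

theorem antitone_subtractiveOrbit (hnonneg : ∀ n a, 0 ≤ subtractiveOrbit s v n a) (a : Letter) :
    Antitone fun n => subtractiveOrbit s v n a := by
  refine antitone_nat_of_succ_le fun n => ?_
  by_cases ha : a = s n
  · rw [subtractiveOrbit, ha, subtractAt_self]
    exact sub_le_self _ (hnonneg n _)
  · rw [subtractiveOrbit, subtractAt_of_ne ha]

/-- A coordinate that reaches `0` stays there, and it would become negative when it is next
reduced. -/
theorem subtractiveOrbit_pos (hnonneg : ∀ n a, 0 ≤ subtractiveOrbit s v n a)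
    (hs : ∀ c, ∃ᶠ n in atTop, s n = c) (hv : v ≠ 0) (n : ℕ) (a : Letter) :
    0 < subtractiveOrbit s v n a := by
  by_contra! hle
  obtain ⟨m, hnm, hm⟩ := frequently_atTop.mp (hs a) n
  have hself : subtractiveOrbit s v m a = 0 :=
    ((antitone_subtractiveOrbit hnonneg a hnm).trans hle).antisymm (hnonneg m a)
  have hother : subtractiveOrbit s v m a.other = 0 := by
    have hnext := hnonneg (m + 1) a
    rw [subtractiveOrbit, hm, subtractAt_self, hself, zero_sub, neg_nonneg] at hnext
    exact hnext.antisymm (hnonneg m a.other)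
  refine subtractiveOrbit_ne_zero s hv m (funext fun c => ?_)
  by_cases hc : c = a
  · rw [hc, hself, Pi.zero_apply]
  · rw [Letter.ne_iff_eq_other.mp hc, hother, Pi.zero_apply]

end AddCommGroup

/-- A run of `b k` subtractions from one coordinate is one step `y ↦ 1 / (y - b k)` of the continued
fraction algorithm on the ratio `y` of the two coordinates. -/
theorem IsRunLength.hasContFractExpansion {s : ℕ → Letter} {b : ℕ → ℕ} (hb : IsRunLength s b)
    {v : Letter → ℝ} (hpos : ∀ n a, 0 < subtractiveOrbit s v n a) :
    HasContFractExpansion (v .one / v .two) b := by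
  let orbit (k : ℕ) : Letter → ℝ := subtractiveOrbit s v (∑ l ∈ Finset.range k, b l)
  let y (k : ℕ) : ℝ := orbit k (runLetter k) / orbit k (runLetter (k + 1))
  have hy_pos (k : ℕ) : 0 < y k := div_pos (hpos _ _) (hpos _ _)
  have hrun (k : ℕ) : orbit (k + 1) = Function.update (orbit k) (runLetter k)
      (orbit k (runLetter k) - b k * orbit k (runLetter (k + 1))) := by
    simp only [orbit, Finset.sum_range_succ, runLetter_succ]
    rw [subtractiveOrbit_add_of_forall_eq (hb.2 k), nsmul_eq_mul, ← runLetter]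
  have hy (k : ℕ) : y k = b k + (y (k + 1))⁻¹ := by
    have hne : orbit k (runLetter (k + 1)) ≠ 0 := (hpos _ _).ne'
    have hyk : (y (k + 1))⁻¹ = (orbit k (runLetter k) - b k * orbit k (runLetter (k + 1))) /
        orbit k (runLetter (k + 1)) := by
      simp only [y]
      rw [inv_div, hrun, runLetter_succ (k + 1), runLetter_succ k, Letter.other_other,
        Function.update_self, Function.update_of_ne (Letter.other_ne _)]
    rw [hyk, sub_div, mul_div_cancel_right₀ _ hne, add_sub_cancel]
  refine hasContFractExpansion_of_recurrence (y := y) (fun k => ?_) hy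
  have hbk : (1 : ℝ) ≤ b (k + 1) := by exact_mod_cast hb.1 (k + 1) k.succ_pos
  rw [hy (k + 1)]
  linarith [inv_pos.mpr (hy_pos (k + 1 + 1))]

end Subtractive

/-! ### Letter frequencies -/

section Frequency

open Filter Topology

variable {i a : Letter} {w : ℕ → Letter} {v f g : Letter → ℝ} {b : ℕ → ℕ}

/-- The number of occurrences of the letter `a` among the first `n` letters of `w`. -/
def letterCount (w : ℕ → Letter) (a : Letter) (n : ℕ) : ℕ :=
  Nat.count (fun k => w k = a) n

theorem letterCount_succ (w : ℕ → Letter) (a : Letter) (n : ℕ) :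
    letterCount w a (n + 1) = letterCount w a n + if w n = a then 1 else 0 :=
  Nat.count_succ _ n

theorem sum_letterCount (w : ℕ → Letter) (n : ℕ) : ∑ a, letterCount w a n = n := by
  induction n with
  | zero => simp [letterCount]
  | succ n ih => simp [letterCount_succ, Finset.sum_add_distrib, ih]

theorem letterCount_eraseBefore (i : Letter) (w : ℕ → Letter) (a : Letter) (n : ℕ) :
    letterCount (eraseBefore i w) a (Nat.count (Kept i w) n) =
      Nat.count (fun k => Kept i w k ∧ w k = a) n := by
  induction n with
  | zero => simp [letterCount]
  | succ n ih =>
    by_cases h : Kept i w n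
    · rw [Nat.count_succ, if_pos h, letterCount_succ, ih, eraseBefore_count h, Nat.count_succ]
      simp only [h, true_and]
    · rw [Nat.count_succ_eq_count_iff.mpr h, ih,
        Nat.count_succ_eq_count_iff.mpr fun hn => h hn.1]

theorem letterCount_eraseBefore_of_ne (ha : a ≠ i) (n : ℕ) :
    letterCount (eraseBefore i w) a (Nat.count (Kept i w) n) = letterCount w a n := by
  have hkept : ∀ k, Kept i w k ∧ w k = a ↔ w k = a := fun k =>
    and_iff_right_of_imp fun hk => kept_of_ne (hk ▸ ha)
  rw [letterCount_eraseBefore]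
  simp only [hkept, letterCount]

/-- Each occurrence of `i.other`, except one at position `0`, has an erased letter `i` before it. -/
theorem letterCount_eraseBefore_self_add (hi : IsSeparating i w) (n : ℕ) :
    letterCount (eraseBefore i w) i (Nat.count (Kept i w) n) + letterCount w i.other (n + 1) =
      letterCount w i n + letterCount w i.other 1 := by
  rw [letterCount_eraseBefore]
  induction n with
  | zero => simp [letterCount]
  | succ n ih =>
    rw [Nat.count_succ, letterCount_succ w _ (n + 1), letterCount_succ w i n]
    have hstep : (if Kept i w n ∧ w n = i then 1 else 0) +
        (if w (n + 1) = i.other then 1 else 0) = if w n = i then 1 else 0 := by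
      rcases eq_or_ne (w n) i with h | h <;> rcases eq_or_ne (w (n + 1)) i with h' | h'
      · simp [Kept, h, h', i.other_ne.symm]
      · simp [Kept, h, Letter.ne_iff_eq_other.mp h', i.other_ne]
      · simp [h, h', i.other_ne.symm]
      · exact ((hi n).elim h h').elim
    omega

theorem abs_letterCount_eraseBefore_self_sub_le (hi : IsSeparating i w) (n : ℕ) :
    |(letterCount (eraseBefore i w) i (Nat.count (Kept i w) n) : ℝ) -
      (letterCount w i n - letterCount w i.other n)| ≤ 1 := by
  have hcount := letterCount_eraseBefore_self_add hi n
  have hzero : letterCount w i.other 0 = 0 := Nat.count_zero _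
  rw [letterCount_succ w _ n, letterCount_succ w _ 0, hzero] at hcount
  have hcast := congrArg (Nat.cast : ℕ → ℝ) hcount
  push_cast at hcast
  rw [abs_le]
  split_ifs at hcast <;> constructor <;> linarith

/-- The vector `v` is a limit of rescaled letter counts of prefixes of `w`, along some filter and
with scaling factors that tend to `0`. Not normalizing `v` makes this notion stable under erasure,
and arbitrary filters allow for cluster points. -/
def IsPrefixCountLimit (w : ℕ → Letter) (v : Letter → ℝ) : Prop :=
  ∃ (F : Filter ℕ) (c : ℕ → ℝ) (len : ℕ → ℕ), F.NeBot ∧ (∀ k, 0 ≤ c k) ∧ Tendsto c F (𝓝 0) ∧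
    ∀ a, Tendsto (fun k => c k * letterCount w a (len k)) F (𝓝 (v a))

theorem IsPrefixCountLimit.nonneg (hv : IsPrefixCountLimit w v) (a : Letter) : 0 ≤ v a := by
  obtain ⟨F, c, len, _, hc, -, hlim⟩ := hv
  exact ge_of_tendsto' (hlim a) fun k => mul_nonneg (hc k) (Nat.cast_nonneg _)

theorem IsPrefixCountLimit.eraseBefore (hv : IsPrefixCountLimit w v) (hi : IsSeparating i w) :
    IsPrefixCountLimit (eraseBefore i w) (subtractAt i v) := by
  obtain ⟨F, c, len, hF, hc, hc0, hlim⟩ := hv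
  refine ⟨F, c, fun k => Nat.count (Kept i w) (len k), hF, hc, hc0, fun a => ?_⟩
  rcases eq_or_ne a i with rfl | ha
  · rw [subtractAt_self]
    refine tendsto_of_tendsto_of_dist ((hlim a).sub (hlim a.other))
      (squeeze_zero (fun _ => dist_nonneg) (fun k => ?_) hc0)
    rw [dist_comm, Real.dist_eq, ← mul_sub, ← mul_sub, abs_mul, abs_of_nonneg (hc k)]
    exact mul_le_of_le_one_right (hc k) (abs_letterCount_eraseBefore_self_sub_le hi _)
  · simpa only [letterCount_eraseBefore_of_ne ha, subtractAt_of_ne ha] using hlim a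

theorem IsPrefixCountLimit.subtractiveOrbit (hv : IsPrefixCountLimit w v) (hw : IsSturmian w)
    (n : ℕ) : IsPrefixCountLimit (renorm^[n] w) (subtractiveOrbit (operatorSeq w) v n) := by
  induction n with
  | zero => exact hv
  | succ n ih =>
    rw [Function.iterate_succ_apply']
    exact ih.eraseBefore (hw.iterate_renorm n).isSeparating_wordType

theorem IsPrefixCountLimit.subtractiveOrbit_pos (hv : IsPrefixCountLimit w v) (hw : IsSturmian w)
    (hv0 : v ≠ 0) (n : ℕ) (a : Letter) : 0 < Sturmian.subtractiveOrbit (operatorSeq w) v n a :=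
  Sturmian.subtractiveOrbit_pos (fun n => (hv.subtractiveOrbit hw n).nonneg)
    hw.frequently_operatorSeq_eq hv0 n a

/-- The proportions of the two letters among the first `n` letters of `w`. -/
noncomputable def letterProportion (w : ℕ → Letter) (n : ℕ) : Letter → ℝ :=
  fun a => (letterCount w a n : ℝ) / n

theorem letterProportion_mem_stdSimplex (w : ℕ → Letter) {n : ℕ} (hn : n ≠ 0) :
    letterProportion w n ∈ stdSimplex ℝ Letter := by
  refine ⟨fun a => div_nonneg (Nat.cast_nonneg _) (Nat.cast_nonneg _), ?_⟩
  simp only [letterProportion]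
  rw [← Finset.sum_div, ← Nat.cast_sum, sum_letterCount, div_self (Nat.cast_ne_zero.mpr hn)]

theorem isPrefixCountLimit_of_mapClusterPt (hf : MapClusterPt f atTop (letterProportion w)) :
    IsPrefixCountLimit w f := by
  obtain ⟨U, hU, hlim⟩ := mapClusterPt_iff_ultrafilter.mp hf
  refine ⟨U, fun n => (n : ℝ)⁻¹, id, U.neBot, fun n => inv_nonneg.mpr n.cast_nonneg,
    tendsto_inv_atTop_nhds_zero_nat.mono_left hU, fun a => ?_⟩
  simpa only [letterProportion, div_eq_inv_mul, id_eq] using tendsto_pi_nhds.mp hlim a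

theorem ne_zero_of_mem_stdSimplex {ι : Type*} [Fintype ι] {x : ι → ℝ}
    (hx : x ∈ stdSimplex ℝ ι) : x ≠ 0 := by
  rintro rfl
  simpa using hx.2

theorem eq_of_mem_stdSimplex_of_div_eq (hf : f ∈ stdSimplex ℝ Letter)
    (hg : g ∈ stdSimplex ℝ Letter) (hf0 : f .two ≠ 0) (hg0 : g .two ≠ 0)
    (h : f .one / f .two = g .one / g .two) : f = g := by
  have hsum (x : Letter → ℝ) (hx : x ∈ stdSimplex ℝ Letter) : x .one + x .two = 1 := by
    rw [← hx.2]; simp [Finset.univ, Fintype.elems]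
  have hf1 := hsum f hf
  have hg1 := hsum g hg
  rw [div_eq_div_iff hf0 hg0] at h
  have htwo : f .two = g .two := by linear_combination g .two * hf1 - f .two * hg1 - h
  funext a
  cases a
  · linarith
  · exact htwo

/-- All cluster points of the proportions have the same continued fraction expansion. -/
theorem IsSturmian.exists_tendsto_letterProportion (hw : IsSturmian w)
    (hb : IsRunLength (operatorSeq w) b) :
    ∃ f, Tendsto (letterProportion w) atTop (𝓝 f) ∧ HasContFractExpansion (f .one / f .two) b := by
  have hmem : ∀ᶠ n in atTop, letterProportion w n ∈ stdSimplex ℝ Letter :=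
    (eventually_ne_atTop 0).mono fun _ => letterProportion_mem_stdSimplex w
  have hpos (f) (hf : f ∈ stdSimplex ℝ Letter) (hcl : MapClusterPt f atTop (letterProportion w)) :
      ∀ n a, 0 < subtractiveOrbit (operatorSeq w) f n a :=
    (isPrefixCountLimit_of_mapClusterPt hcl).subtractiveOrbit_pos hw (ne_zero_of_mem_stdSimplex hf)
  obtain ⟨f, hf, hfcl⟩ := (isCompact_stdSimplex ℝ Letter).exists_mapClusterPt
    (le_principal_iff.mpr hmem)
  have hfb := hb.hasContFractExpansion (hpos f hf hfcl)
  refine ⟨f, (isCompact_stdSimplex ℝ Letter).tendsto_nhds_of_unique_mapClusterPt hmem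
    fun g hg hgcl => ?_, hfb⟩
  exact eq_of_mem_stdSimplex_of_div_eq hg hf (hpos g hg hgcl 0 _).ne' (hpos f hf hfcl 0 _).ne'
    ((hb.hasContFractExpansion (hpos g hg hgcl)).unique hfb)

end Frequency

end Sturmian

theorem mainTheorem8 (w : ℕ → Sturmian.Letter) (hw : Sturmian.IsSturmian w) :
    (∃! b : ℕ → ℕ, Sturmian.IsRunLength (Sturmian.operatorSeq w) b) ∧
    ∃ f₁ f₂ : ℝ,
      Sturmian.HasFrequency w Sturmian.Letter.one f₁ ∧
      Sturmian.HasFrequency w Sturmian.Letter.two f₂ ∧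
      (∀ b : ℕ → ℕ, Sturmian.IsRunLength (Sturmian.operatorSeq w) b →
        Sturmian.HasContFractExpansion (f₁ / f₂) b) ∧
      Irrational (f₁ / f₂) := by
  obtain ⟨b, hb⟩ := Sturmian.exists_isRunLength hw.frequently_operatorSeq_eq
  obtain ⟨f, hf, hfb⟩ := hw.exists_tendsto_letterProportion hb
  have hfreq (a : Sturmian.Letter) : Sturmian.HasFrequency w a (f a) := tendsto_pi_nhds.mp hf a
  exact ⟨⟨b, hb, fun _ hb' => hb'.unique hb⟩, f .one, f .two, hfreq .one, hfreq .two,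
    fun _ hb' => hb.unique hb' ▸ hfb, hfb.irrational⟩
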